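/- Let $\mathbb D=\{z\in\mathbb C:|z|<1\}$ and $\mathbb T=\{z\in\mathbb C:|z|=1\}$. Let $\sigma$ be normalized Lebesgue measure on $\mathbb T$. Let $A(\overline{\mathbb D})$ be the disk algebra, that is, the algebra with the supremum norm of all continuous functions $f:\overline{\mathbb D}\to\mathbb C$ that are holomorphic in $\mathbb D$. Identify $\overline{\mathbb D}$ as usual with the character space of $A(\overline{\mathbb D})$, each point $z$ corresponding to the evaluation $f\mapsto f(z)$. A subset $E$ of the character space of a commutative Banach algebra $A$ is called $t$-analytic for $A$ if, for every $f\in A$ and every nonempty relatively open subset $U$ of $E$, if (the Gelfand transform of) $f$ vanishes identically on $U$, then it vanishes identically on $E$. Theorem. Let $E\subseteq\overline{\mathbb D}$ be a closed set with at least two points. Then $E$ is $t$-analytic for $A(\overline{\mathbb D})$ if and only if the following two conditions hold: (1) $E$ has no isolated points; (2) for every open arc $I\subseteq\mathbb T$ with $I\cap\overline{E\cap\mathbb D}=\emptyset$, either $I\cap E=\emptyset$ or $\sigma(I\cap E)>0$. -/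

import Mathlib

open Set Metric MeasureTheory Topology WeakDual

noncomputable section

/-- Let `A` be a commutative complex normed algebra and let `E` be a subset of its character space
`M(A)` (with the Gelfand topology). Then `E` is `t`-analytic for `A` if every `f` in `A` whose
Gelfand transform `φ ↦ φ f` vanishes on some nonempty relatively open subset `O ∩ E` of `E`
vanishes on all of `E`. -/
def IsTAnalytic (A : Type*) [NormedCommRing A] [NormedAlgebra ℂ A]
    (E : Set (characterSpace ℂ A)) : Prop :=
  ∀ (f : A) (O : Set (characterSpace ℂ A)), IsOpen O → (O ∩ E).Nonempty →
    (∀ φ ∈ O ∩ E, φ f = 0) → ∀ φ ∈ E, φ f = 0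

/-- The disk algebra: the continuous functions on the closed unit disk which are holomorphic in the
open unit disk, with the supremum norm inherited from `C(closedBall 0 1, ℂ)`. -/
def diskAlgebra : Subalgebra ℂ C(closedBall (0 : ℂ) 1, ℂ) where
  carrier := {f | ∃ g : ℂ → ℂ, DifferentiableOn ℂ g (ball 0 1) ∧
    ∀ z : closedBall (0 : ℂ) 1, (z : ℂ) ∈ ball (0 : ℂ) 1 → f z = g z}
  mul_mem' := by
    rintro f₁ f₂ ⟨g₁, h₁, e₁⟩ ⟨g₂, h₂, e₂⟩
    exact ⟨g₁ * g₂, h₁.mul h₂, fun z hz => by simp [e₁ z hz, e₂ z hz]⟩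
  add_mem' := by
    rintro f₁ f₂ ⟨g₁, h₁, e₁⟩ ⟨g₂, h₂, e₂⟩
    exact ⟨g₁ + g₂, h₁.add h₂, fun z hz => by simp [e₁ z hz, e₂ z hz]⟩
  algebraMap_mem' c := ⟨fun _ => c, differentiableOn_const c, fun _ _ => rfl⟩

/-- The evaluation at a point of the closed unit disk, as a character of the disk algebra. This is
the usual identification of the closed unit disk with the character space of the disk algebra. -/
def evalCharacter (z : closedBall (0 : ℂ) 1) : characterSpace ℂ diskAlgebra :=
  ⟨StrongDual.toWeakDual
      ((ContinuousMap.evalCLM ℂ z).comp (Subalgebra.toSubmodule diskAlgebra).subtypeL), by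
    refine ⟨fun h => ?_, fun f g => rfl⟩
    have h1 := DFunLike.congr_fun h (1 : diskAlgebra)
    exact one_ne_zero (α := ℂ) h1⟩

/-- Normalized Lebesgue measure on the unit circle, as a Borel measure on `ℂ` concentrated on the
unit circle: the image of `dt / (2π)` on `(0, 2π]` under `t ↦ exp (i t)`. -/
def normalizedArcMeasure : Measure ℂ :=
  (ENNReal.ofReal (2 * Real.pi))⁻¹ •
    (volume.restrict (Ioc 0 (2 * Real.pi))).map (circleMap 0 1)

/-- `I` is an open arc of the unit circle: `I = {exp (i t) : a < t < b}` with `a < b`. -/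
def IsOpenArc (I : Set ℂ) : Prop :=
  ∃ a b : ℝ, a < b ∧ I = circleMap 0 1 '' Ioo a b

end

/-! A function in the disk algebra that vanishes on a relatively open piece of `E` must vanish
identically once that piece is a uniqueness set. If the piece meets the open disk, the absence of
isolated points gives accumulating zeros there. Otherwise a small arc around one of its points
misses the closure of `E ∩ ball 0 1`, so (2) gives positive measure, and
`DiffContOnCl.eqOn_zero_of_arcMeasure_pos` (via Jensen) applies. Conversely, `x - z` detects an
isolated point `z`, and a null piece of `E` on an arc contains a compact piece that is the exact
zero set of a Fatou function (`exists_diffContOnCl_zero_iff_mem`). That function is `exp (-H)`,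
where `H` is a sum of peaks with real part tending to infinity at the set. -/

/-! ### Boundary uniqueness -/

/-- Jensen's formula bounds the circle averages of `log ‖f‖` from below, uniformly in the radius. -/
theorem AnalyticOnNhd.exists_le_circleAverage_log_norm {f : ℂ → ℂ}
    (hf : AnalyticOnNhd ℂ f (ball 0 1)) :
    ∃ C : ℝ, ∀ r ∈ Ico (1 / 2 : ℝ) 1, C ≤ Real.circleAverage (fun z => Real.log ‖f z‖) 0 r := by
  set d : ℤ := ((analyticOrderAt f 0).map ((↑) : ℕ → ℤ)).untop₀ with hd
  refine ⟨d * Real.log (1 / 2) + Real.log ‖meromorphicTrailingCoeffAt f 0‖, fun r hr => ?_⟩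
  have hr0 : 0 < r := by linarith [hr.1]
  have hsub : closedBall (0 : ℂ) |r| ⊆ ball 0 1 := by
    rw [abs_of_pos hr0]
    exact closedBall_subset_ball hr.2
  have hf' := hf.mono hsub
  rw [hf'.meromorphicOn.circleAverage_log_norm hr0.ne', MeromorphicOn.AnalyticOnNhd.divisor_apply hf' (by simp), ← hd]
  have hd0 : (0 : ℝ) ≤ d := by
    have := MeromorphicOn.AnalyticOnNhd.divisor_nonneg hf' 0
    rw [MeromorphicOn.AnalyticOnNhd.divisor_apply hf' (by simp)] at this
    exact_mod_cast this
  have h1 : (d : ℝ) * Real.log (1 / 2) ≤ d * Real.log r :=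
    mul_le_mul_of_nonneg_left (Real.log_le_log (by norm_num) hr.1) hd0
  have h2 : (0 : ℝ) ≤ ∑ᶠ u, (MeromorphicOn.divisor f (closedBall 0 |r|) u : ℝ) *
      Real.log (r * ‖(0 : ℂ) - u‖⁻¹) := by
    refine finsum_nonneg fun u => ?_
    by_cases hu : u ∈ closedBall (0 : ℂ) |r|
    · refine mul_nonneg (mod_cast MeromorphicOn.AnalyticOnNhd.divisor_nonneg hf' u) ?_
      by_cases hu0 : u = 0
      · simp [hu0]
      · apply Real.log_nonneg
        have h3 : 0 < ‖(0 : ℂ) - u‖ := by simpa using hu0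
        rw [mem_closedBall_zero_iff, abs_of_pos hr0] at hu
        rw [← div_eq_mul_inv, le_div_iff₀ h3]
        simpa using hu
    · simp [hu]
  linarith

/-- A function holomorphic in the unit disk and continuous up to the boundary that is not
identically zero has `log (max ‖F‖ η)` with boundary averages bounded below, uniformly in `η`. -/
theorem DiffContOnCl.exists_le_circleAverage_log_max {F : ℂ → ℂ}
    (hF : DiffContOnCl ℂ F (ball 0 1)) (hne : ∃ z ∈ ball (0 : ℂ) 1, F z ≠ 0) :
    ∃ C : ℝ, ∀ η > 0, C ≤ Real.circleAverage (fun z => Real.log (max ‖F z‖ η)) 0 1 := by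
  have hA : AnalyticOnNhd ℂ F (ball 0 1) := hF.differentiableOn.analyticOnNhd isOpen_ball
  have hc : ContinuousOn F (closedBall 0 1) := by
    have := hF.continuousOn
    rwa [closure_ball _ one_ne_zero] at this
  obtain ⟨C, hC⟩ := hA.exists_le_circleAverage_log_norm
  refine ⟨C, fun η hη => ?_⟩
  have hGc : ContinuousOn (fun z => Real.log (max ‖F z‖ η)) (closedBall 0 1) :=
    (ContinuousOn.sup hc.norm continuousOn_const).log fun z _ => (lt_max_of_lt_right hη).ne'
  have hle : ∀ r ∈ Ico (1 / 2 : ℝ) 1,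
      C ≤ Real.circleAverage (fun z => Real.log (max ‖F z‖ η)) 0 r := by
    intro r hr
    have hr0 : 0 < r := by linarith [hr.1]
    have hS : sphere (0 : ℂ) |r| ⊆ ball 0 1 := by
      rw [abs_of_pos hr0]
      exact sphere_subset_closedBall.trans (closedBall_subset_ball hr.2)
    refine (hC r hr).trans ?_
    have hGi : CircleIntegrable (fun z => Real.log (max ‖F z‖ η)) 0 r :=
      ContinuousOn.circleIntegrable' (hGc.mono (hS.trans ball_subset_closedBall))
    have hLi : CircleIntegrable (fun z => Real.log ‖F z‖) 0 r :=
      (hA.mono hS).meromorphicOn.circleIntegrable_log_norm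
    have hcod : {z | F z ≠ 0} ∈ Filter.codiscreteWithin (sphere (0 : ℂ) |r|) := by
      rw [mem_codiscreteWithin_iff_forall_mem_nhdsNE]
      intro x hx
      have hev : ∀ᶠ z in 𝓝[≠] x, F z ≠ 0 := by
        by_contra h
        obtain ⟨z, hz, hz0⟩ := hne
        refine hz0 (hA.eqOn_zero_of_preconnected_of_frequently_eq_zero
          (convex_ball _ _).isPreconnected (hS hx) ?_ hz)
        exact fun h' => h h'
      filter_upwards [hev] with z hz using Or.inl hz
    -- `Real.log 0 = 0` may exceed `log η`, so the values at the zeros of `F` are replaced before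
    -- comparing; averages ignore this discrete set.
    have hcongr : (fun z => Real.log ‖F z‖) =ᶠ[Filter.codiscreteWithin (sphere (0 : ℂ) |r|)]
        fun z => if F z = 0 then Real.log η else Real.log ‖F z‖ := by
      filter_upwards [hcod] with z hz
      exact (if_neg hz).symm
    rw [Real.circleAverage_congr_codiscreteWithin hcongr hr0.ne']
    refine Real.circleAverage_mono (hLi.congr_codiscreteWithin hcongr) hGi fun z _ => ?_
    split_ifs with h
    · exact Real.log_le_log hη (le_max_right _ _)
    · exact Real.log_le_log (norm_pos_iff.2 h) (le_max_left _ _)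
  -- The truncation at `η` makes the integrand continuous up to the circle, so the bound passes to
  -- the limit `r → 1`.
  have hcont : ContinuousOn (Real.circleAverage (fun z => Real.log (max ‖F z‖ η)) 0)
      (Icc (1 / 2) 1) := by
    refine Real.ContinuousOn.circleAverage (hGc.mono fun z hz => ?_) fun r hr => by linarith [hr.1]
    simpa using hz.2
  have h1 := (hcont 1 (by norm_num)).mono Ico_subset_Icc_self
  have : (𝓝[Ico (1 / 2 : ℝ) 1] 1).NeBot := by
    rw [← mem_closure_iff_nhdsWithin_neBot, closure_Ico (by norm_num)]
    norm_num
  exact ge_of_tendsto h1 (by filter_upwards [self_mem_nhdsWithin] with r hr using hle r hr)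

theorem normalizedArcMeasure_apply {S : Set ℂ} (hS : MeasurableSet S) :
    normalizedArcMeasure S = (ENNReal.ofReal (2 * Real.pi))⁻¹ *
      volume (circleMap 0 1 ⁻¹' S ∩ Ioc 0 (2 * Real.pi)) := by
  rw [normalizedArcMeasure, Measure.smul_apply, Measure.map_apply (by fun_prop) hS,
    Measure.restrict_apply (hS.preimage (by fun_prop)), smul_eq_mul]

/-- Boundary uniqueness for the disk algebra: a function that is not identically zero vanishes
only on a null set of the circle. -/
theorem DiffContOnCl.eqOn_zero_of_arcMeasure_pos {F : ℂ → ℂ}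
    (hF : DiffContOnCl ℂ F (ball 0 1)) {S : Set ℂ} (hS : MeasurableSet S)
    (hpos : 0 < normalizedArcMeasure S) (hzero : ∀ z ∈ S, F z = 0) :
    EqOn F 0 (closedBall 0 1) := by
  have hc : ContinuousOn F (closedBall 0 1) := by
    have := hF.continuousOn
    rwa [closure_ball _ one_ne_zero] at this
  suffices h : EqOn F 0 (ball 0 1) by
    have := h.of_subset_closure hc continuousOn_const ball_subset_closedBall
      (by rw [closure_ball _ one_ne_zero])
    exact this
  by_contra hcon
  have hne : ∃ z ∈ ball (0 : ℂ) 1, F z ≠ 0 := by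
    simpa [EqOn] using hcon
  obtain ⟨C, hC⟩ := hF.exists_le_circleAverage_log_max hne
  obtain ⟨M, hM⟩ := (isCompact_closedBall (0 : ℂ) 1).exists_bound_of_continuousOn hc
  set T : Set ℝ := circleMap 0 1 ⁻¹' S with hT
  have hTm : MeasurableSet T := hS.preimage (by fun_prop)
  set m : ℝ := (volume.restrict (Ioc 0 (2 * Real.pi))).real T with hm
  have hm0 : 0 < m := by
    rw [normalizedArcMeasure_apply hS] at hpos
    refine ENNReal.toReal_pos ?_ (measure_ne_top _ _)
    rw [Measure.restrict_apply hTm]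
    exact (pos_of_mul_pos_right hpos (by simp)).ne'
  set N := max M 1
  have hN1 : 1 ≤ N := le_max_right _ _
  have key : ∀ η : ℝ, 0 < η → η ≤ 1 →
      2 * Real.pi * C ≤ Real.log η * m + 2 * Real.pi * Real.log N := by
    intro η hη hη1
    have h1 := hC η hη
    rw [Real.circleAverage_def, smul_eq_mul, intervalIntegral.integral_of_le (by positivity),
      ← div_eq_inv_mul, le_div_iff₀ (by positivity), mul_comm] at h1
    refine h1.trans ?_
    have hGc : Continuous fun θ : ℝ => Real.log (max ‖F (circleMap 0 1 θ)‖ η) := by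
      refine Continuous.log ?_ fun θ => (lt_max_of_lt_right hη).ne'
      refine (Continuous.norm ?_).max continuous_const
      exact hc.comp_continuous (by fun_prop) fun θ => by simp
    have hGi : Integrable (fun θ : ℝ => Real.log (max ‖F (circleMap 0 1 θ)‖ η))
        (volume.restrict (Ioc 0 (2 * Real.pi))) :=
      (hGc.integrableOn_Icc (a := 0) (b := 2 * Real.pi)).mono_set Ioc_subset_Icc_self
    have hI : Integrable (fun θ : ℝ => T.indicator (fun _ => Real.log η) θ + Real.log N)
        (volume.restrict (Ioc 0 (2 * Real.pi))) :=
      ((integrable_const _).indicator hTm).add (integrable_const _)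
    refine (integral_mono hGi hI fun θ => ?_).trans_eq ?_
    · by_cases hθ : θ ∈ T
      · have : F (circleMap 0 1 θ) = 0 := hzero _ hθ
        simpa [this, hθ, hη.le] using Real.log_nonneg hN1
      · simp only [hθ, not_false_eq_true, indicator_of_notMem, zero_add]
        refine Real.log_le_log (lt_max_of_lt_right hη) (max_le ?_ (hη1.trans hN1))
        exact (hM _ (by simp)).trans (le_max_left _ _)
    · rw [integral_add ((integrable_const _).indicator hTm) (integrable_const _),
        integral_indicator hTm, setIntegral_const, integral_const]
      simp only [smul_eq_mul, measureReal_restrict_apply_univ, Real.volume_real_Ioc, sub_zero]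
      rw [max_eq_left (by positivity), ← hm]
      ring
  -- With `log η = -(|D| + 1)`, `key` becomes `(|D| + 1) * m ≤ D * m`, which is absurd.
  set D : ℝ := (2 * Real.pi * Real.log N - 2 * Real.pi * C) / m with hD
  have h2 := key (Real.exp (-(|D| + 1))) (Real.exp_pos _)
    (Real.exp_le_one_iff.2 (by linarith [abs_nonneg D]))
  rw [Real.log_exp] at h2
  have h3 : D * m = 2 * Real.pi * Real.log N - 2 * Real.pi * C := div_mul_cancel₀ _ hm0.ne'
  nlinarith [le_abs_self D, hm0]

/-! ### Fatou's theorem on zero sets -/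

/-- A null subset of the circle is null for the one-dimensional Hausdorff measure. -/
theorem hausdorffMeasure_one_eq_zero_of_arcMeasure {K : Set ℂ} (hK : K ⊆ sphere 0 1)
    (hKm : MeasurableSet K) (h0 : normalizedArcMeasure K = 0) :
    Measure.hausdorffMeasure 1 K = 0 := by
  rw [normalizedArcMeasure_apply hKm, mul_eq_zero] at h0
  have h1 : volume (circleMap 0 1 ⁻¹' K ∩ Ioc 0 (2 * Real.pi)) = 0 := 
    h0.resolve_left (ENNReal.inv_ne_zero.2 ENNReal.ofReal_ne_top)
  have hsub : K ⊆ circleMap 0 1 '' (circleMap 0 1 ⁻¹' K ∩ Ioc 0 (2 * Real.pi)) := by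
    intro z hz
    have : z ∈ circleMap 0 1 '' Ioc 0 (2 * Real.pi) := by
      rw [image_circleMap_Ioc]
      simpa using hK hz
    obtain ⟨t, ht, rfl⟩ := this
    exact ⟨t, ⟨hz, ht⟩, rfl⟩
  refine measure_mono_null hsub (le_antisymm ?_ zero_le)
  refine ((lipschitzWith_circleMap 0 1).hausdorffMeasure_image_le zero_le_one _).trans ?_
  rw [hausdorffMeasure_real, h1, mul_zero]

/-- A compact null subset of the circle is covered by finitely many disks with small total radius
and centers in the set. -/
theorem exists_finset_cover_of_arcMeasure_eq_zero {K : Set ℂ} (hK : K ⊆ sphere 0 1)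
    (hKc : IsCompact K) (hne : K.Nonempty) (h0 : normalizedArcMeasure K = 0) {ε : ℝ} (hε : 0 < ε) :
    ∃ (s : Finset ℕ) (ζ : ℕ → ℂ) (δ : ℕ → ℝ), (∀ n, 0 < δ n) ∧ (∀ n, ζ n ∈ K) ∧
      K ⊆ ⋃ n ∈ s, ball (ζ n) (δ n) ∧ ∑ n ∈ s, δ n ≤ ε := by
  have hH := hausdorffMeasure_one_eq_zero_of_arcMeasure hK hKc.measurableSet h0
  rw [Measure.hausdorffMeasure_apply] at hH
  -- Any scale would do; scale `1` only keeps the diameters finite.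
  have hH1 := (iSup₂_le_iff.1 hH.le) 1 one_pos
  have hlt := lt_of_le_of_lt hH1 (ENNReal.ofReal_pos.2 (half_pos hε))
  simp only [iInf_lt_iff] at hlt
  obtain ⟨t, hKt, htd, hsum⟩ := hlt
  set d : ℕ → ENNReal := fun n => ⨆ _ : (t n).Nonempty, ediam (t n) ^ (1 : ℝ) with hd
  have hd1 : ∀ n, d n ≤ 1 := fun n => iSup_le fun _ => by simpa using htd n
  have hdt : ∀ n, d n ≠ ⊤ := fun n => ((hd1 n).trans_lt ENNReal.one_lt_top).ne
  have hζ : ∀ n, ∃ ζ ∈ K, (K ∩ t n).Nonempty → ζ ∈ t n := by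
    intro n
    by_cases h : (K ∩ t n).Nonempty
    · obtain ⟨x, hx⟩ := h
      exact ⟨x, hx.1, fun _ => hx.2⟩
    · obtain ⟨x, hx⟩ := hne
      exact ⟨x, hx, fun h' => (h h').elim⟩
  choose ζ hζK hζt using hζ
  -- The slack makes the radii positive and the balls open covers; it sums to `ε / 2`.
  set δ : ℕ → ℝ := fun n => (d n).toReal + ε / 2 / 2 / 2 ^ n with hδ
  have hδ0 : ∀ n, 0 < δ n := fun n => by positivity
  have hcov : K ⊆ ⋃ n, ball (ζ n) (δ n) := by
    intro x hx
    obtain ⟨n, hn⟩ := mem_iUnion.1 (hKt hx)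
    have hz := hζt n ⟨x, hx, hn⟩
    refine mem_iUnion.2 ⟨n, ?_⟩
    have h1 : edist x (ζ n) ≤ d n := by
      refine (edist_le_ediam_of_mem hn hz).trans ?_
      simpa [hd] using le_iSup (fun _ : (t n).Nonempty => ediam (t n) ^ (1 : ℝ)) ⟨x, hn⟩
    rw [mem_ball, dist_edist]
    have h2 := ENNReal.toReal_mono (hdt n) h1
    have h3 : 0 < ε / 2 / 2 / 2 ^ n := by positivity
    simp only [hδ]
    linarith
  obtain ⟨s, hs⟩ := hKc.elim_finite_subcover _ (fun n => isOpen_ball) hcov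
  refine ⟨s, ζ, δ, hδ0, hζK, hs, ?_⟩
  rw [hδ, Finset.sum_add_distrib]
  have h1 : ∑ n ∈ s, (d n).toReal ≤ ε / 2 := by
    rw [← ENNReal.toReal_sum fun n _ => hdt n]
    exact ENNReal.toReal_le_of_le_ofReal (half_pos hε).le ((ENNReal.sum_le_tsum s).trans hsum.le)
  have h2 : ∑ n ∈ s, ε / 2 / 2 / 2 ^ n ≤ ε / 2 := by
    refine ((summable_geometric_two' (ε / 2)).sum_le_tsum s fun n _ => by positivity).trans_eq ?_
    exact tsum_geometric_two' (ε / 2)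
  linarith

/-- Bounds for the elementary peak `z ↦ δ / (1 + δ - conj ζ * z)` at a point `ζ` of the circle. -/
theorem peak_bounds {ζ z : ℂ} {δ : ℝ} (hζ : ‖ζ‖ = 1) (hz : ‖z‖ ≤ 1) (hδ : 0 < δ) :
    1 + δ - starRingEnd ℂ ζ * z ≠ 0 ∧
    0 ≤ ((δ : ℂ) / (1 + δ - starRingEnd ℂ ζ * z)).re ∧
    (‖z - ζ‖ < δ → 1 / 4 ≤ ((δ : ℂ) / (1 + δ - starRingEnd ℂ ζ * z)).re) ∧
    ‖(δ : ℂ) / (1 + δ - starRingEnd ℂ ζ * z)‖ * ‖z - ζ‖ ≤ δ := by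
  -- The peak is `δ / (u + δ)` with `‖u‖ = ‖z - ζ‖` and `0 ≤ u.re`, whence `‖u‖ ≤ ‖u + δ‖`.
  set u : ℂ := 1 - starRingEnd ℂ ζ * z with hu
  have hw : (1 + δ - starRingEnd ℂ ζ * z : ℂ) = u + δ := by rw [hu]; ring
  rw [hw]
  have hun : ‖u‖ = ‖z - ζ‖ := by
    have h1 : starRingEnd ℂ ζ * (ζ - z) = u := by
      rw [mul_sub, Complex.conj_mul', hζ, hu]; simp
    rw [← h1, norm_mul, RCLike.norm_conj, hζ, one_mul, norm_sub_rev]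
  have hur : 0 ≤ u.re := by
    have h2 : (starRingEnd ℂ ζ * z).re ≤ 1 := by
      refine (Complex.re_le_norm _).trans ?_
      rw [norm_mul, RCLike.norm_conj, hζ, one_mul]
      exact hz
    simpa [hu] using h2
  have hwr : (u + δ).re = u.re + δ := by simp
  have hne : u + δ ≠ 0 := by
    intro h
    rw [h] at hwr
    simp at hwr
    linarith
  have hns : 0 < Complex.normSq (u + δ) := Complex.normSq_pos.2 hne
  have hre : ((δ : ℂ) / (u + δ)).re = δ * (u.re + δ) / Complex.normSq (u + δ) := by
    rw [Complex.div_re]; simp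
  have hnsq : Complex.normSq (u + δ) = (u.re + δ) ^ 2 + u.im ^ 2 := by
    rw [Complex.normSq_apply]; simp; ring
  have hu2 : ‖u‖ ^ 2 = u.re ^ 2 + u.im ^ 2 := by
    rw [← Complex.normSq_eq_norm_sq, Complex.normSq_apply]; ring
  refine ⟨hne, ?_, fun hlt => ?_, ?_⟩
  · rw [hre]; positivity
  · rw [hre, le_div_iff₀ hns, hnsq]
    rw [← hun] at hlt
    have h3 : ‖u‖ ^ 2 ≤ δ ^ 2 := by gcongr
    nlinarith
  · rw [← hun, norm_div, Complex.norm_real, Real.norm_of_nonneg hδ.le, div_mul_eq_mul_div,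
      div_le_iff₀ (norm_pos_iff.2 hne)]
    refine mul_le_mul_of_nonneg_left ?_ hδ.le
    rw [← sq_le_sq₀ (norm_nonneg _) (norm_nonneg _), hu2, ← Complex.normSq_eq_norm_sq, hnsq]
    nlinarith

/-- Add the elementary peaks over a cover of total radius at most `ε`. Real parts are nonnegative,
so one large term suffices on `V`; centers lie in `K`, so `infDist z K` is at most each `‖z - ζ n‖`.
-/
theorem exists_peak_function {K : Set ℂ} (hK : K ⊆ sphere 0 1) (hKc : IsCompact K)
    (hne : K.Nonempty) (h0 : normalizedArcMeasure K = 0) {ε : ℝ} (hε : 0 < ε) :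
    ∃ (h : ℂ → ℂ) (V : Set ℂ), IsOpen V ∧ K ⊆ V ∧
      (∀ z ∈ closedBall (0 : ℂ) 1, DifferentiableAt ℂ h z ∧ 0 ≤ (h z).re ∧
        (z ∈ V → 1 / 4 ≤ (h z).re) ∧ ‖h z‖ * infDist z K ≤ ε) := by
  obtain ⟨s, ζ, δ, hδ, hζ, hcov, hsum⟩ :=
    exists_finset_cover_of_arcMeasure_eq_zero hK hKc hne h0 hε
  have hζ1 : ∀ n, ‖ζ n‖ = 1 := fun n => by simpa using hK (hζ n)
  refine ⟨fun z => ∑ n ∈ s, (δ n : ℂ) / (1 + δ n - starRingEnd ℂ (ζ n) * z),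
    ⋃ n ∈ s, ball (ζ n) (δ n), isOpen_biUnion fun n _ => isOpen_ball, hcov, fun z hz => ?_⟩
  have hz1 : ‖z‖ ≤ 1 := by simpa using hz
  have hb := fun n => peak_bounds (hζ1 n) hz1 (hδ n)
  refine ⟨?_, ?_, fun hzV => ?_, ?_⟩
  · refine DifferentiableAt.fun_sum fun n _ => ?_
    exact (differentiableAt_const _).div (by fun_prop) (hb n).1
  · rw [Complex.re_sum]
    exact Finset.sum_nonneg fun n _ => (hb n).2.1
  · rw [Complex.re_sum]
    obtain ⟨n, hn, hzn⟩ := mem_iUnion₂.1 hzV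
    refine ((hb n).2.2.1 (by simpa [dist_eq_norm] using hzn)).trans ?_
    exact Finset.single_le_sum
      (f := fun n => ((δ n : ℂ) / (1 + δ n - starRingEnd ℂ (ζ n) * z)).re)
      (fun n _ => (hb n).2.1) hn
  · refine le_trans ?_ hsum
    refine (mul_le_mul_of_nonneg_right (norm_sum_le _ _) infDist_nonneg).trans ?_
    rw [Finset.sum_mul]
    refine Finset.sum_le_sum fun n _ => le_trans ?_ (hb n).2.2.2
    refine mul_le_mul_of_nonneg_left ?_ (norm_nonneg _)
    rw [← dist_eq_norm]
    exact infDist_le_dist_of_mem (hζ n)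

/-- Fatou's theorem: a compact null subset of the circle is the zero set of a function in the disk
algebra. -/
theorem exists_diffContOnCl_zero_iff_mem {K : Set ℂ} (hK : K ⊆ sphere 0 1) (hKc : IsCompact K)
    (hne : K.Nonempty) (h0 : normalizedArcMeasure K = 0) :
    ∃ f : ℂ → ℂ, DiffContOnCl ℂ f (ball 0 1) ∧ ∀ z, f z = 0 ↔ z ∈ K := by
  classical
  have hex : ∀ n : ℕ, (0 : ℝ) < (1 / 2) ^ n := fun n => by positivity
  choose h V hVo hKV hh using fun n => exists_peak_function hK hKc hne h0 (hex n)
  set H : ℂ → ℂ := fun z => ∑' n, h n z with hH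
  have hbound : ∀ ρ > 0, ∀ n, ∀ z ∈ closedBall (0 : ℂ) 1, ρ < infDist z K →
      ‖h n z‖ ≤ (1 / 2) ^ n * ρ⁻¹ := by
    intro ρ hρ n z hz hzK
    rw [← div_eq_mul_inv, le_div_iff₀ hρ]
    exact (mul_le_mul_of_nonneg_left hzK.le (norm_nonneg _)).trans (hh n z hz).2.2.2
  have hsumm : ∀ ρ : ℝ, Summable fun n : ℕ => (1 / 2 : ℝ) ^ n * ρ⁻¹ := fun ρ =>
    summable_geometric_two.mul_right _
  have hpos : ∀ z, z ∉ K → 0 < infDist z K := fun z hz =>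
    (hKc.isClosed.notMem_iff_infDist_pos hne).1 hz
  have hopen : ∀ ρ : ℝ, IsOpen {z : ℂ | ρ < infDist z K} := fun ρ =>
    isOpen_lt continuous_const (continuous_infDist_pt K)
  have hHcont : ∀ z ∈ closedBall (0 : ℂ) 1, z ∉ K → ContinuousWithinAt H (closedBall 0 1) z := by
    intro z hz hzK
    have hp := hpos z hzK
    have hc : ContinuousOn H (closedBall 0 1 ∩ {w | infDist z K / 2 < infDist w K}) := by
      refine continuousOn_tsum (fun n w hw => ?_) (hsumm (infDist z K / 2)) fun n w hw =>
        hbound _ (half_pos hp) n w hw.1 hw.2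
      exact (hh n w hw.1).1.continuousAt.continuousWithinAt
    exact (hc z ⟨hz, half_lt_self hp⟩).mono_of_mem_nhdsWithin
      (inter_mem_nhdsWithin _ ((hopen _).mem_nhds (half_lt_self hp)))
  have hHdiff : ∀ z ∈ ball (0 : ℂ) 1, z ∉ K → DifferentiableAt ℂ H z := by
    intro z hz hzK
    have hp := hpos z hzK
    have hU : IsOpen (ball (0 : ℂ) 1 ∩ {w | infDist z K / 2 < infDist w K}) :=
      isOpen_ball.inter (hopen _)
    have hd : DifferentiableOn ℂ H (ball 0 1 ∩ {w | infDist z K / 2 < infDist w K}) := by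
      refine Complex.differentiableOn_tsum_of_summable_norm (hsumm (infDist z K / 2))
        (fun n w hw => ?_) hU fun n w hw =>
          hbound _ (half_pos hp) n w (ball_subset_closedBall hw.1) hw.2
      exact (hh n w (ball_subset_closedBall hw.1)).1.differentiableWithinAt
    exact hd.differentiableAt (hU.mem_nhds ⟨hz, half_lt_self hp⟩)
  have hHre : ∀ N : ℕ, ∀ z ∈ closedBall (0 : ℂ) 1, z ∉ K → (∀ n ∈ Finset.range N, z ∈ V n) →
      (N : ℝ) / 4 ≤ (H z).re := by
    intro N z hz hzK hzV
    have hp := hpos z hzK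
    have hs : Summable fun n => h n z := Summable.of_norm_bounded (hsumm (infDist z K / 2))
      fun n => hbound _ (half_pos hp) n z hz (half_lt_self hp)
    rw [hH, Complex.re_tsum hs]
    refine le_trans ?_ ((Complex.hasSum_re hs.hasSum).summable.sum_le_tsum (Finset.range N)
      fun n _ => (hh n z hz).2.1)
    refine le_trans (le_of_eq ?_) (Finset.card_nsmul_le_sum _ _ (1 / 4) fun n hn =>
      (hh n z hz).2.2.1 (hzV n hn))
    simp; ring
  have hKball : ∀ z ∈ ball (0 : ℂ) 1, z ∉ K := fun z hz hzK => by
    have h1 := hK hzK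
    simp only [mem_sphere_iff_norm, sub_zero] at h1
    simp [h1] at hz
  -- On `K` the series for `H` need not converge, so the value `0` is imposed there; `exp` vanishes
  -- nowhere else.
  refine ⟨fun z => if z ∈ K then 0 else Complex.exp (-H z), ⟨fun z hz => ?_, ?_⟩, fun z => ?_⟩
  · have hd : DifferentiableAt ℂ (fun w => Complex.exp (-H w)) z :=
      (hHdiff z hz (hKball z hz)).neg.cexp
    refine hd.differentiableWithinAt.congr (fun w hw => ?_) ?_
    · simp [hKball w hw]
    · simp [hKball z hz]
  · rw [closure_ball _ one_ne_zero]
    intro z hz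
    by_cases hzK : z ∈ K
    · rw [Metric.continuousWithinAt_iff']
      intro ε hε
      obtain ⟨N, hN⟩ : ∃ N : ℕ, Real.exp (-(N / 4 : ℝ)) < ε := by
        obtain ⟨N, hN⟩ := exists_nat_gt (4 * -Real.log ε)
        refine ⟨N, ?_⟩
        rw [← Real.lt_log_iff_exp_lt hε]
        linarith
      have hV : ∀ᶠ w in 𝓝 z, ∀ n ∈ Finset.range N, w ∈ V n :=
        (Filter.eventually_all_finset _).2 fun n _ => (hVo n).mem_nhds (hKV n hzK)
      filter_upwards [self_mem_nhdsWithin, hV.filter_mono nhdsWithin_le_nhds] with w hw hwV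
      by_cases hwK : w ∈ K
      · simpa [hzK, hwK] using hε
      · simp only [hzK, hwK, if_true, if_false, dist_zero_right, Complex.norm_exp, Complex.neg_re]
        refine lt_of_le_of_lt (Real.exp_le_exp.2 (neg_le_neg ?_)) hN
        exact hHre N w hw hwK hwV
    · have hc := (hHcont z hz hzK).neg.cexp
      refine hc.congr_of_eventuallyEq ?_ (by simp [hzK])
      filter_upwards [nhdsWithin_le_nhds (hKc.isClosed.isOpen_compl.mem_nhds hzK)] with w hw
      exact if_neg hw
  · by_cases hzK : z ∈ K <;> simp [hzK]

/-! ### From characters to points of the disk -/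

theorem continuous_evalCharacter : Continuous evalCharacter := by
  refine Continuous.subtype_mk (WeakBilin.continuous_of_continuous_eval _ fun f => ?_) _
  exact f.1.continuous

theorem DiffContOnCl.exists_diskAlgebra {g : ℂ → ℂ} (hg : DiffContOnCl ℂ g (ball 0 1)) :
    ∃ f : diskAlgebra, ∀ z : closedBall (0 : ℂ) 1, evalCharacter z f = g z := by
  have hc := hg.continuousOn
  rw [closure_ball _ one_ne_zero] at hc
  exact ⟨⟨⟨fun z => g z, continuousOn_iff_continuous_domRestrict.1 hc⟩,
    g, hg.differentiableOn, fun _ _ => rfl⟩, fun _ => rfl⟩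

theorem exists_diffContOnCl_of_diskAlgebra (f : diskAlgebra) :
    ∃ g : ℂ → ℂ, DiffContOnCl ℂ g (ball 0 1) ∧
      ∀ z : closedBall (0 : ℂ) 1, evalCharacter z f = g z := by
  classical
  obtain ⟨g, hg, hfg⟩ := f.2
  set F : ℂ → ℂ := fun w => if h : w ∈ closedBall (0 : ℂ) 1 then f.1 ⟨w, h⟩ else 0 with hF
  have hFf : ∀ z : closedBall (0 : ℂ) 1, F z = f.1 z := fun z => dif_pos z.2
  refine ⟨F, ⟨hg.congr fun z hz => ?_, ?_⟩, fun z => (hFf z).symm⟩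
  · exact (hFf ⟨z, ball_subset_closedBall hz⟩).trans (hfg ⟨z, ball_subset_closedBall hz⟩ hz)
  · rw [closure_ball _ one_ne_zero, continuousOn_iff_continuous_domRestrict]
    exact f.1.continuous.congr fun z => (hFf z).symm

/-- `t`-analyticity for the disk algebra in terms of functions on the closed disk. -/
theorem isTAnalytic_diskAlgebra_iff {E : Set ℂ} (hED : E ⊆ closedBall (0 : ℂ) 1) :
    IsTAnalytic diskAlgebra (evalCharacter '' {z : closedBall (0 : ℂ) 1 | (z : ℂ) ∈ E}) ↔
      ∀ g : ℂ → ℂ, DiffContOnCl ℂ g (ball 0 1) → ∀ O : Set ℂ, IsOpen O → (O ∩ E).Nonempty →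
        (∀ z ∈ O ∩ E, g z = 0) → ∀ z ∈ E, g z = 0 := by
  constructor
  · intro h g hg O hO hne hz z hzE
    obtain ⟨f, hf⟩ := hg.exists_diskAlgebra
    -- The coordinate function turns an open set of the plane into a Gelfand-open set.
    obtain ⟨e, he⟩ := (differentiable_id.diffContOnCl :
      DiffContOnCl ℂ (fun w : ℂ => w) (ball 0 1)).exists_diskAlgebra
    have hcont : Continuous fun φ : characterSpace ℂ diskAlgebra => φ e :=
      (WeakDual.eval_continuous e).comp continuous_subtype_val
    rw [← hf ⟨z, hED hzE⟩]
    refine h f {φ | φ e ∈ O} (hO.preimage hcont) ?_ ?_ _ ⟨⟨z, hED hzE⟩, hzE, rfl⟩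
    · obtain ⟨w, hwO, hwE⟩ := hne
      exact ⟨evalCharacter ⟨w, hED hwE⟩, by simpa [he] using hwO, ⟨w, hED hwE⟩, hwE, rfl⟩
    · rintro _ ⟨hφ, w, hwE, rfl⟩
      rw [hf]
      exact hz w ⟨by simpa [he] using hφ, hwE⟩
  · rintro h f O hO ⟨_, hwO, w, hwE, rfl⟩ hz _ ⟨z, hzE, rfl⟩
    obtain ⟨g, hg, hfg⟩ := exists_diffContOnCl_of_diskAlgebra f
    obtain ⟨W, hW, hWO⟩ := isOpen_induced_iff.1 (hO.preimage continuous_evalCharacter)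
    rw [hfg]
    refine h g hg W hW ⟨w, ?_, hwE⟩ (fun x hx => ?_) z hzE
    · exact hWO.ge hwO
    · rw [← hfg ⟨x, hED hx.2⟩]
      exact hz _ ⟨hWO.le (show (⟨x, hED hx.2⟩ : closedBall (0 : ℂ) 1) ∈ _ from hx.1),
        ⟨x, hED hx.2⟩, hx.2, rfl⟩

/-! ### Arcs and the equivalence -/

/-- Open arcs are relatively open in the circle. -/
theorem IsOpenArc.exists_ball_inter_sphere_subset {I : Set ℂ} (hI : IsOpenArc I) {z : ℂ}
    (hz : z ∈ I) : ∃ ε > 0, ball z ε ∩ sphere 0 1 ⊆ I := by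
  obtain ⟨a, b, -, rfl⟩ := hI
  obtain ⟨t, ht, rfl⟩ := hz
  have hne : circleMap 0 1 t ≠ 0 := circleMap_ne_center one_ne_zero
  have hc : ContinuousAt (fun w => t + Complex.arg (w / circleMap 0 1 t)) (circleMap 0 1 t) := by
    refine continuousAt_const.add (ContinuousAt.comp (g := Complex.arg) ?_ (by fun_prop))
    rw [div_self hne]
    exact Complex.continuousAt_arg Complex.one_mem_slitPlane
  have hev := hc.eventually_mem (s := Ioo a b) (by
    rw [div_self hne, Complex.arg_one, add_zero]
    exact Ioo_mem_nhds ht.1 ht.2)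
  obtain ⟨ε, hε, h⟩ := Metric.eventually_nhds_iff_ball.1 hev
  refine ⟨ε, hε, fun w hw => ⟨_, h w hw.1, ?_⟩⟩
  have hn : ‖w / circleMap 0 1 t‖ = 1 := by
    have : ‖w‖ = 1 := by simpa using hw.2
    simp [this]
  have h1 := Complex.norm_mul_exp_arg_mul_I (w / circleMap 0 1 t)
  rw [hn, Complex.ofReal_one, one_mul, eq_div_iff hne] at h1
  refine Eq.trans ?_ h1
  simp only [circleMap, Complex.ofReal_add, Complex.ofReal_one, zero_add, one_mul, add_mul,
    Complex.exp_add]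
  exact mul_comm _ _

/-- Every point of the circle has arbitrarily small open arcs around it. -/
theorem exists_isOpenArc_subset {z : ℂ} (hz : z ∈ sphere (0 : ℂ) 1) {O : Set ℂ} (hO : IsOpen O)
    (hzO : z ∈ O) : ∃ I, IsOpenArc I ∧ z ∈ I ∧ I ⊆ O := by
  have : z ∈ range (circleMap 0 1) := by simpa [range_circleMap] using hz
  obtain ⟨t, rfl⟩ := this
  obtain ⟨a, b, hab, h⟩ := mem_nhds_iff_exists_Ioo_subset.1
    ((hO.preimage (continuous_circleMap 0 1)).mem_nhds hzO)
  exact ⟨_, ⟨a, b, hab.1.trans hab.2, rfl⟩, ⟨t, hab, rfl⟩, image_subset_iff.2 h⟩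

theorem arcMeasure_pos_of_vanishing {E : Set ℂ} (hE : IsClosed E)
    (hED : E ⊆ closedBall (0 : ℂ) 1) (hE2 : E.Nontrivial)
    (h : ∀ g : ℂ → ℂ, DiffContOnCl ℂ g (ball 0 1) → ∀ O : Set ℂ, IsOpen O → (O ∩ E).Nonempty →
      (∀ z ∈ O ∩ E, g z = 0) → ∀ z ∈ E, g z = 0)
    {I : Set ℂ} (hI : IsOpenArc I) (hd : Disjoint I (closure (E ∩ ball (0 : ℂ) 1))) :
    I ∩ E = ∅ ∨ 0 < normalizedArcMeasure (I ∩ E) := by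
  by_contra! hcon
  obtain ⟨⟨z, hzI, hzE⟩, hnull⟩ := hcon
  obtain ⟨w, hwE, hwz⟩ := hE2.exists_ne z
  obtain ⟨ε₁, hε₁, hsub⟩ := hI.exists_ball_inter_sphere_subset hzI
  obtain ⟨ε₂, hε₂, hsub₂⟩ := Metric.isOpen_iff.1 isClosed_closure.isOpen_compl z
    (disjoint_left.1 hd hzI)
  -- Small enough that `closedBall z r` meets the circle inside `I`, misses the closure of `E ∩ ball
  -- 0 1`, and excludes `w`.
  set r := min (min ε₁ ε₂) (dist w z) / 2 with hr
  have hdp : 0 < dist w z := dist_pos.2 hwz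
  have hm : 0 < min (min ε₁ ε₂) (dist w z) := lt_min (lt_min hε₁ hε₂) hdp
  have hr0 : 0 < r := half_pos hm
  have hr1 : r < min (min ε₁ ε₂) (dist w z) := half_lt_self hm
  obtain ⟨hr12, hrd⟩ := lt_min_iff.1 hr1
  obtain ⟨hrε₁, hrε₂⟩ := lt_min_iff.1 hr12
  have hKs : closedBall z r ∩ E ⊆ sphere 0 1 := by
    rintro x ⟨hx, hxE⟩
    have h1 := hsub₂ (closedBall_subset_ball hrε₂ hx)
    have h2 : x ∉ ball (0 : ℂ) 1 := fun hxb => h1 (subset_closure ⟨hxE, hxb⟩)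
    have h3 := hED hxE
    rw [mem_closedBall] at h3
    rw [mem_ball, not_lt] at h2
    exact le_antisymm h3 h2
  have hKI : closedBall z r ∩ E ⊆ I ∩ E := fun x hx =>
    ⟨hsub ⟨closedBall_subset_ball hrε₁ hx.1, hKs hx⟩, hx.2⟩
  have h0 : normalizedArcMeasure (closedBall z r ∩ E) = 0 :=
    measure_mono_null hKI (le_antisymm hnull zero_le)
  have hKc : IsCompact (closedBall z r ∩ E) := (isCompact_closedBall z r).inter_right hE
  obtain ⟨f, hf, hfK⟩ := exists_diffContOnCl_zero_iff_mem hKs hKc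
    ⟨z, mem_closedBall_self hr0.le, hzE⟩ h0
  have hw := h f hf (ball z r) isOpen_ball ⟨z, mem_ball_self hr0, hzE⟩
    (fun x hx => (hfK x).2 ⟨ball_subset_closedBall hx.1, hx.2⟩) w hwE
  have := ((hfK w).1 hw).1
  rw [mem_closedBall] at this
  exact absurd this (not_le.2 hrd)

theorem mainTheorem5 (E : Set ℂ) (hE : IsClosed E) (hED : E ⊆ closedBall (0 : ℂ) 1)
    (hE2 : E.Nontrivial) :
    IsTAnalytic diskAlgebra (evalCharacter '' {z : closedBall (0 : ℂ) 1 | (z : ℂ) ∈ E}) ↔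
      (∀ z ∈ E, AccPt z (Filter.principal E)) ∧
      ∀ I : Set ℂ, IsOpenArc I → Disjoint I (closure (E ∩ ball (0 : ℂ) 1)) →
        I ∩ E = ∅ ∨ 0 < normalizedArcMeasure (I ∩ E) := by
  rw [isTAnalytic_diskAlgebra_iff hED]
  constructor
  · refine fun h => ⟨fun z hzE => ?_, fun I hI hd => arcMeasure_pos_of_vanishing hE hED hE2 h hI hd⟩
    rw [accPt_iff_nhds]
    by_contra! hcon
    obtain ⟨U, hU, hUE⟩ := hcon
    obtain ⟨O, hOU, hO, hzO⟩ := _root_.mem_nhds_iff.1 hU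
    obtain ⟨w, hwE, hwz⟩ := hE2.exists_ne z
    refine hwz (sub_eq_zero.1 (h (fun x => x - z) ?_ O hO ⟨z, hzO, hzE⟩ (fun x hx => ?_) w hwE))
    · exact (differentiable_id.sub_const z).diffContOnCl
    · exact sub_eq_zero.2 (hUE x ⟨hOU hx.1, hx.2⟩)
  · rintro ⟨h1, h2⟩ g hg O hO ⟨z, hzO, hzE⟩ hg0
    have hc := hg.continuousOn
    rw [closure_ball _ one_ne_zero] at hc
    suffices EqOn g 0 (closedBall 0 1) from fun w hw => this (hED hw)
    by_cases hint : (O ∩ E ∩ ball 0 1).Nonempty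
    · obtain ⟨x, ⟨hxO, hxE⟩, hxb⟩ := hint
      have hA : AnalyticOnNhd ℂ g (ball 0 1) := hg.differentiableOn.analyticOnNhd isOpen_ball
      have hfreq : ∃ᶠ y in 𝓝[≠] x, g y = 0 := by
        have h3 := (accPt_iff_frequently_nhdsNE.1 (h1 x hxE)).and_eventually
          (nhdsWithin_le_nhds (hO.mem_nhds hxO))
        exact h3.mono fun y hy => hg0 y ⟨hy.2, hy.1⟩
      have h4 := hA.eqOn_zero_of_preconnected_of_frequently_eq_zero
        (convex_ball _ _).isPreconnected hxb hfreq
      exact h4.of_subset_closure hc continuousOn_const ball_subset_closedBall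
        (by rw [closure_ball _ one_ne_zero])
    · rw [not_nonempty_iff_eq_empty] at hint
      have hzs : z ∈ sphere (0 : ℂ) 1 := by
        have h3 : z ∉ ball (0 : ℂ) 1 := fun hzb => hint.le ⟨⟨hzO, hzE⟩, hzb⟩
        rw [mem_ball, not_lt] at h3
        exact le_antisymm (hED hzE) h3
      obtain ⟨I, hI, hzI, hsub⟩ := exists_isOpenArc_subset hzs hO hzO
      -- An open set missing `E ∩ ball 0 1` also misses its closure.
      have hdisj : Disjoint O (closure (E ∩ ball (0 : ℂ) 1)) := by
        refine Disjoint.closure_right ?_ hO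
        rw [disjoint_iff_inter_eq_empty, ← inter_assoc]
        exact hint
      have hpos : 0 < normalizedArcMeasure (I ∩ E) :=
        (h2 I hI (hdisj.mono_left hsub)).resolve_left (nonempty_iff_ne_empty.1 ⟨z, hzI, hzE⟩)
      refine hg.eqOn_zero_of_arcMeasure_pos (hO.measurableSet.inter hE.measurableSet)
        (hpos.trans_le (measure_mono (inter_subset_inter_left _ hsub))) hg0
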